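/- **Generalized (parameterized) tangential-sphere bound.** Let $n\ge 3$ and $\sigma>0$, and let $\mathcal C\subset\mathbb R^n$ be a finite set of $M\ge 1$ non-zero vectors (codewords), not necessarily of equal norm. A codeword $\underline s$, chosen with probability $1/M$, is sent over an AWGN channel: $\underline y=\underline s+\underline z$, where $\underline z$ has independent $N(0,\sigma^2)$ components, and $\underline y$ is decoded by maximum likelihood (ties broken arbitrarily). Let $\Pr\{E\}=\frac1M\sum_{\underline s}\Pr\{E\mid\underline s\}$ be the decoding error probability. Let $$B_{\delta_{d_1},\delta_{d_2},\delta_d}=\frac1M\sum_{\underline s\in\mathcal C,\ \|\underline s\|=\delta_{d_1}}\#\{\underline{\hat s}\in\mathcal C:\ \|\underline{\hat s}\|=\delta_{d_2},\ \|\underline s-\underline{\hat s}\|=\delta_d\}$$ be the triangle Euclidean distance spectrum. Put $$\theta=\arccos\frac{\delta_{d_1}^2+\delta_d^2-\delta_{d_2}^2}{2\delta_{d_1}\delta_d},\qquad \beta_d(z)=\frac{\delta_d-2z\cos\theta}{2\sin\theta},\qquad \Phi(a)=\frac{\Gamma(\frac{n-1}2)}{\sqrt\pi\,\Gamma(\frac{n-2}2)}\int_0^{a}\sin^{n-3}\phi\,d\phi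 ,$$ $$p_2(z,r,\delta_{d_1},\delta_{d_2},\delta_d)=\begin{cases}\Phi\big(\arccos\frac{\beta_d(z)}r\big), & \beta_d(z)>0,\ r\ge\beta_d(z),\\ 0,&\beta_d(z)>0,\ r<\beta_d(z),\\ 1-\Phi\big(\arccos\frac{|\beta_d(z)|}r\big), & \beta_d(z)\le 0,\ r\ge|\beta_d(z)|,\\ 1,&\beta_d(z)\le 0,\ r<|\beta_d(z)|,\end{cases}$$ where, if $\sin\theta=0$ (two codewords on a line through the origin), $\beta_d(z)$ is read as $+\infty$, so that $p_2=0$, when $\delta_d-2z\cos\theta>0$, and as $-\infty$, so that $p_2=1$, otherwise. Let $$f_s(z,r)=\sum_{\delta_{d_1},\ \delta_{d_2},\ \delta_d>0}B_{\delta_{d_1},\delta_{d_2},\delta_d}\;p_2(z,r,\delta_{d_1},\delta_{d_2},\delta_d),$$ where $\delta_{d_1},\delta_{d_2}$ range over the norms of codewords and $\delta_d$ over the distances between distinct codewords, and let $$g_s(r)=\frac{2r^{n-2}e^{-r^2/(2\sigma^2)}}{2^{\frac{n-1}2}\sigma^{n-1}\Gamma(\frac{n-1}2)}\quad(r\ge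 0),\qquad g(z)=\frac1{\sqrt{2\pi}\,\sigma}e^{-z^2/(2\sigma^2)} .$$ Then $$\Pr\{E\}\le\int_{-\infty}^{+\infty}\min\Big\{\int_0^{+\infty}\min\{f_s(z,r),1\}\,g_s(r)\,dr,\ 1\Big\}\,g(z)\,dz .$$ -/

import Mathlib

noncomputable section

namespace TSB

open MeasureTheory ProbabilityTheory

/-! ### The AWGN channel and maximum-likelihood decoding -/

/-- The law of the noise vector: `n` independent centred Gaussian components of variance `σ ^ 2`. -/
def awgnNoise (n : ℕ) (σ : ℝ) : Measure (EuclideanSpace ℝ (Fin n)) :=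
  (Measure.pi fun _ : Fin n => gaussianReal 0 (σ ^ 2).toNNReal).map (WithLp.toLp 2)

/-- The likelihood of the received vector `y` when `s` is sent: the density at `y` of the law of
`s` plus the noise. -/
def likelihood {n : ℕ} (σ : ℝ) (s y : EuclideanSpace ℝ (Fin n)) : ℝ :=
  ∏ i, gaussianPDFReal (s i) (σ ^ 2).toNNReal (y i)

/-- `D` is a maximum-likelihood decoder for the code `C` (ties may be broken in any way). -/
def IsMLDecoder {n : ℕ} (σ : ℝ) (C : Finset (EuclideanSpace ℝ (Fin n)))
    (D : EuclideanSpace ℝ (Fin n) → EuclideanSpace ℝ (Fin n)) : Prop :=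
  ∀ y, D y ∈ C ∧ ∀ s ∈ C, likelihood σ s y ≤ likelihood σ (D y) y

/-- The conditional decoding error probability `Pr{E | s}`. -/
def condErrorProb {n : ℕ} (σ : ℝ) (D : EuclideanSpace ℝ (Fin n) → EuclideanSpace ℝ (Fin n))
    (s : EuclideanSpace ℝ (Fin n)) : ℝ :=
  (awgnNoise n σ).real {z | D (s + z) ≠ s}

/-- The decoding error probability `Pr{E}`, each codeword being sent with probability `1 / M`. -/
def errorProb {n : ℕ} (σ : ℝ) (C : Finset (EuclideanSpace ℝ (Fin n)))
    (D : EuclideanSpace ℝ (Fin n) → EuclideanSpace ℝ (Fin n)) : ℝ :=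
  ∑ s ∈ C, 1 / (C.card : ℝ) * condErrorProb σ D s

/-! ### The triangle Euclidean distance spectrum -/

/-- The conditional spectrum of a codeword `s`: if `s` has energy `δ₁ ^ 2`, the number of codewords
of energy `δ₂ ^ 2` at distance `δ` from `s`; it is zero for the other values of `δ₁`. -/
def condTriangleSpectrum {n : ℕ} (C : Finset (EuclideanSpace ℝ (Fin n)))
    (s : EuclideanSpace ℝ (Fin n)) (δ₁ δ₂ δ : ℝ) : ℝ :=
  if ‖s‖ = δ₁ then ((C.filter fun t => ‖t‖ = δ₂ ∧ dist s t = δ).card : ℝ) else 0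

/-- The triangle Euclidean distance spectrum: the average of the conditional spectra. -/
def triangleSpectrum {n : ℕ} (C : Finset (EuclideanSpace ℝ (Fin n))) (δ₁ δ₂ δ : ℝ) : ℝ :=
  ∑ s ∈ C, 1 / (C.card : ℝ) * condTriangleSpectrum C s δ₁ δ₂ δ

/-- The norms of the codewords. -/
def normValues {n : ℕ} (C : Finset (EuclideanSpace ℝ (Fin n))) : Finset ℝ :=
  C.image fun s => ‖s‖

/-- The distances between distinct codewords. -/
def distValues {n : ℕ} (C : Finset (EuclideanSpace ℝ (Fin n))) : Finset ℝ :=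
  ((C ×ˢ C).image fun p => dist p.1 p.2).filter fun δ => 0 < δ

/-! ### The conditional pair-wise error probability -/

/-- The angle at the transmitted codeword in the triangle formed with the competing codeword and
the origin. -/
def theta (δ₁ δ₂ δ : ℝ) : ℝ :=
  Real.arccos ((δ₁ ^ 2 + δ ^ 2 - δ₂ ^ 2) / (2 * δ₁ * δ))

/-- The signed distance, inside the hyperplane where the radial noise component equals `z`, from
the centre to the trace of the perpendicular bisector (used only when `sin θ ≠ 0`). -/
def beta (δ₁ δ₂ δ z : ℝ) : ℝ :=
  (δ - 2 * z * Real.cos (theta δ₁ δ₂ δ)) / (2 * Real.sin (theta δ₁ δ₂ δ))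

/-- The fraction of the sphere in `ℝ ^ (n - 1)` covered by a cap of half-angle `a`. -/
def capFraction (n : ℕ) (a : ℝ) : ℝ :=
  Real.Gamma (((n : ℝ) - 1) / 2) / (Real.sqrt Real.pi * Real.Gamma (((n : ℝ) - 2) / 2)) *
    ∫ φ in (0 : ℝ)..a, Real.sin φ ^ (n - 3)

/-- The pair-wise error probability given the radial noise component `z` and the norm `r` of the
tangential noise. The branch `sin θ = 0` is that of two codewords on a line through the origin; the
bisector is then parallel to the hyperplane, that is, `β = +∞` (value 0) or `β = -∞` (value 1). -/
def pairError (n : ℕ) (z r δ₁ δ₂ δ : ℝ) : ℝ :=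
  if Real.sin (theta δ₁ δ₂ δ) = 0 then
    if 0 < δ - 2 * z * Real.cos (theta δ₁ δ₂ δ) then 0 else 1
  else if 0 < beta δ₁ δ₂ δ z then
    if beta δ₁ δ₂ δ z ≤ r then capFraction n (Real.arccos (beta δ₁ δ₂ δ z / r)) else 0
  else
    if |beta δ₁ δ₂ δ z| ≤ r then 1 - capFraction n (Real.arccos (|beta δ₁ δ₂ δ z| / r)) else 1

/-! ### The ingredients of the bound -/

/-- `f_s(z, r)`: the union bound averaged over the codewords. -/
def fs {n : ℕ} (C : Finset (EuclideanSpace ℝ (Fin n))) (z r : ℝ) : ℝ :=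
  ∑ δ₁ ∈ normValues C, ∑ δ₂ ∈ normValues C, ∑ δ ∈ distValues C,
    triangleSpectrum C δ₁ δ₂ δ * pairError n z r δ₁ δ₂ δ

/-- The density of the norm of the tangential noise. -/
def gs (n : ℕ) (σ r : ℝ) : ℝ :=
  2 * r ^ (n - 2) * Real.exp (-r ^ 2 / (2 * σ ^ 2)) /
    ((2 : ℝ) ^ (((n : ℝ) - 1) / 2) * σ ^ (n - 1) * Real.Gamma (((n : ℝ) - 1) / 2))

/-- The density of the radial noise component. -/
def g (σ z : ℝ) : ℝ :=
  1 / (Real.sqrt (2 * Real.pi) * σ) * Real.exp (-z ^ 2 / (2 * σ ^ 2))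

end TSB

end

/-!
Maximum-likelihood decoding picks a codeword nearest to the received vector, so an error on the
transmitted codeword `s` means that the noise `x` satisfies `⟪t - s, x⟫ ≥ ‖t - s‖ ^ 2 / 2` for some
other codeword `t`. The Gaussian noise is isotropic: split along `-s / ‖s‖`, it has a radial
component `z` of density `g`, and a tangential component whose norm `r` has density `gs` and whose
direction is independent and uniform on the unit sphere of a space of dimension `n - 1`
(`awgnNoise_apply_preimage`). Given `z` and `r`, the half-space above restricts that direction to a
spherical cap, of normalized surface measure at most `pairError`
(`toSphere_pairwise_le_pairError`). The measure of a cap is computed in `toSphere_cap`; once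
`capFraction` is known to be the normalized measure of a cap, the case distinctions in `pairError`
collapse to one formula (`pairError_eq_capFraction`).

For each `s`, the conditional error probability given `z` and `r` is therefore at most the minimum
of `1` and the sum of `pairError` over the competitors `t` (`awgnNoise_error_le`). The densities
`g` and `gs` do not depend on `s`, so the average over `s` may be taken under the integral sign,
where concavity of `min · 1` (`sum_min_condUnionBound_le`) leads to `f_s`, which is the average of
the conditional union bounds (`fs_eq_sum_condUnionBound`).

The estimates are carried out with Lebesgue integrals in `ℝ≥0∞` and are transferred to Bochner
integrals at the end.
-/

open MeasureTheory ProbabilityTheory Set Metric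
open scoped ENNReal

namespace TSB

/-! ### Spherical coordinates and orthogonal splittings -/

/-- Integration in spherical coordinates. -/
theorem lintegral_eq_lintegral_Ioi_toSphere {E : Type*} [NormedAddCommGroup E] [NormedSpace ℝ E]
    [MeasurableSpace E] [BorelSpace E] [FiniteDimensional ℝ E] [Nontrivial E] (μ : Measure E)
    [μ.IsAddHaarMeasure] {f : E → ℝ≥0∞} (hf : Measurable f) :
    ∫⁻ x, f x ∂μ = ∫⁻ r in Ioi (0 : ℝ), ENNReal.ofReal (r ^ (Module.finrank ℝ E - 1)) *
      ∫⁻ ω, f (r • (ω : E)) ∂μ.toSphere := by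
  have hm : Measurable fun q : sphere (0 : E) 1 × Ioi (0 : ℝ) ↦ f ((q.2 : ℝ) • (q.1 : E)) := by
    fun_prop
  have hin : Measurable fun r : ℝ ↦ ∫⁻ ω, f (r • (ω : E)) ∂μ.toSphere := by
    have : Measurable fun q : ℝ × sphere (0 : E) 1 ↦ f (q.1 • (q.2 : E)) := by fun_prop
    exact this.lintegral_prod_right'
  calc ∫⁻ x, f x ∂μ
      = ∫⁻ x : ({0}ᶜ : Set E), f x ∂(μ.comap (↑)) := by
        rw [lintegral_subtype_comap (measurableSet_singleton _).compl, restrict_compl_singleton]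
    _ = ∫⁻ q : sphere (0 : E) 1 × Ioi (0 : ℝ), f ((q.2 : ℝ) • (q.1 : E))
          ∂(μ.toSphere.prod (.volumeIoiPow (Module.finrank ℝ E - 1))) := by
        rw [← μ.measurePreserving_homeomorphUnitSphereProd.lintegral_comp hm]
        refine lintegral_congr fun x ↦ ?_
        congr 1
        have hx : ‖(x : E)‖ ≠ 0 := norm_ne_zero_iff.2 x.2
        simp [smul_smul, hx]
    _ = ∫⁻ r : Ioi (0 : ℝ), ∫⁻ ω, f ((r : ℝ) • (ω : E)) ∂μ.toSphere
          ∂(.volumeIoiPow (Module.finrank ℝ E - 1)) := by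
        rw [lintegral_prod_symm' _ hm]
    _ = _ := by
        have hin' : Measurable fun r : Ioi (0 : ℝ) ↦ ∫⁻ ω, f ((r : ℝ) • (ω : E)) ∂μ.toSphere :=
          hin.comp measurable_subtype_coe
        rw [Measure.volumeIoiPow, lintegral_withDensity_eq_lintegral_mul _ (by fun_prop) hin',
          ← lintegral_subtype_comap measurableSet_Ioi]
        rfl

/-- The orthogonal splitting of a Euclidean space into the line spanned by a unit vector `u` and its
orthogonal complement, the latter identified with a Euclidean space of one dimension less. -/
theorem exists_linear_split {d : ℕ} (u : EuclideanSpace ℝ (Fin (d + 1))) (hu : ‖u‖ = 1) :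
    ∃ T : EuclideanSpace ℝ (Fin (d + 1)) →ₗ[ℝ] ℝ × EuclideanSpace ℝ (Fin d),
      MeasurePreserving T volume (volume.prod volume) ∧ (∀ x, (T x).1 = inner ℝ u x) ∧
      ∀ x y, inner ℝ x y = (T x).1 * (T y).1 + inner ℝ (T x).2 (T y).2 := by
  obtain ⟨b, hb⟩ := Orthonormal.exists_orthonormalBasis_extension_of_card_eq (𝕜 := ℝ)
    (E := EuclideanSpace ℝ (Fin (d + 1))) (ι := Fin (d + 1)) (by simp) (v := fun _ ↦ u) (s := {0})
    (by
      refine ⟨fun i ↦ by simpa [Set.domRestrict] using hu, fun i j hij ↦ (hij ?_).elim⟩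
      exact Subsingleton.elim _ _)
  have hb0 : b 0 = u := hb 0 rfl
  refine ⟨{ toFun := fun x ↦ (b.repr x 0, WithLp.toLp 2 fun i : Fin d ↦ b.repr x i.succ)
            map_add' := fun x y ↦ by ext <;> simp
            map_smul' := fun c x ↦ by ext <;> simp }, ?_, ?_, ?_⟩
  · have h1 := (PiLp.volume_preserving_ofLp (Fin (d + 1))).comp b.measurePreserving_repr
    have h2 := (volume_preserving_piFinSuccAbove (fun _ : Fin (d + 1) ↦ ℝ) 0).comp h1
    exact ((MeasurePreserving.id volume).prod (PiLp.volume_preserving_toLp (Fin d))).comp h2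
  · intro x
    simp [b.repr_apply_apply, hb0]
  · intro x y
    rw [← b.repr.inner_map_map, PiLp.inner_apply, Fin.sum_univ_succ, PiLp.inner_apply]
    simp [mul_comm]

/-! ### Product densities -/

theorem lintegral_pi_prod {n : ℕ} (μ : Fin n → Measure ℝ) [∀ i, SigmaFinite (μ i)]
    (f : Fin n → ℝ → ℝ≥0∞) (hf : ∀ i, Measurable (f i)) :
    ∫⁻ x, ∏ i, f i (x i) ∂(Measure.pi μ) = ∏ i, ∫⁻ t, f i t ∂(μ i) := by
  induction n with
  | zero => simp
  | succ n ih =>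
    have hm : Measurable fun q : ℝ × (Fin n → ℝ) ↦ f 0 q.1 * ∏ i : Fin n, f i.succ (q.2 i) := by
      refine ((hf 0).comp measurable_fst).mul (Finset.measurable_prod _ fun i _ ↦ ?_)
      exact (hf i.succ).comp ((measurable_pi_apply i).comp measurable_snd)
    have h := (measurePreserving_piFinSuccAbove μ 0).lintegral_comp hm
    rw [Fin.prod_univ_succ, ← ih (fun i ↦ μ i.succ) (fun i ↦ f i.succ) fun i ↦ hf _,
      ← lintegral_prod_mul (hf 0).aemeasurable (Finset.measurable_prod _ fun i _ ↦
        (hf i.succ).comp (measurable_pi_apply i)).aemeasurable]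
    simp only [Fin.prod_univ_succ]
    exact h

theorem pi_withDensity {n : ℕ} (p : ℝ → ℝ≥0∞) (hp : Measurable p)
    [SigmaFinite ((volume : Measure ℝ).withDensity p)] :
    Measure.pi (fun _ : Fin n ↦ (volume : Measure ℝ).withDensity p) =
      (volume : Measure (Fin n → ℝ)).withDensity fun x ↦ ∏ i, p (x i) := by
  refine Measure.pi_eq fun s hs ↦ ?_
  rw [withDensity_apply _ (MeasurableSet.univ_pi hs), ← lintegral_indicator (.univ_pi hs)]
  have : ∀ x : Fin n → ℝ, (univ.pi s).indicator (fun x ↦ ∏ i, p (x i)) x =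
      ∏ i, (s i).indicator p (x i) := by
    intro x
    by_cases h : x ∈ univ.pi s
    · rw [indicator_of_mem h]
      exact Finset.prod_congr rfl fun i _ ↦ (indicator_of_mem (h i trivial) _).symm
    · rw [indicator_of_notMem h]
      obtain ⟨i, hi⟩ : ∃ i, x i ∉ s i := by simpa [Set.mem_pi] using h
      exact (Finset.prod_eq_zero (Finset.mem_univ i) (indicator_of_notMem hi _)).symm
  simp only [this]
  rw [volume_pi, lintegral_pi_prod _ _ fun i ↦ hp.indicator (hs i)]
  exact Finset.prod_congr rfl fun i _ ↦ by
    rw [lintegral_indicator (hs i), withDensity_apply _ (hs i)]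

/-! ### The surface measure of spheres and caps -/

theorem toSphere_volume_univ {d : ℕ} (hd : 0 < d) :
    (volume : Measure (EuclideanSpace ℝ (Fin d))).toSphere univ =
      ENNReal.ofReal (2 * Real.sqrt Real.pi ^ d / Real.Gamma ((d : ℝ) / 2)) := by
  have : Nonempty (Fin d) := ⟨⟨0, hd⟩⟩
  have hd' : (0 : ℝ) < d := by exact_mod_cast hd
  rw [Measure.toSphere_apply_univ, EuclideanSpace.volume_ball]
  simp only [ENNReal.ofReal_one, one_pow, one_mul, finrank_euclideanSpace, Fintype.card_fin]
  rw [← ENNReal.ofReal_natCast, ← ENNReal.ofReal_mul hd'.le, Real.Gamma_add_one (by positivity)]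
  congr 1
  have := Real.Gamma_pos_of_pos (half_pos hd')
  field_simp

theorem toSphere_volume_univ_ne_zero {d : ℕ} (hd : 0 < d) :
    (volume : Measure (EuclideanSpace ℝ (Fin d))).toSphere univ ≠ 0 := by
  have : Nonempty (Fin d) := ⟨⟨0, hd⟩⟩
  exact Measure.measure_univ_ne_zero.2 (Measure.toSphere_ne_zero volume)

/-- The indicator function of the part of the unit disc that a cone of half-angle `a` about the
first axis cuts out. -/
noncomputable def sectorIndicator (a : ℝ) : ℝ × ℝ → ℝ≥0∞ :=
  {q : ℝ × ℝ | √(q.1 ^ 2 + q.2 ^ 2) < 1 ∧ Real.cos a * √(q.1 ^ 2 + q.2 ^ 2) ≤ q.1}.indicator 1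

theorem measurable_sectorIndicator (a : ℝ) : Measurable (sectorIndicator a) := by
  have h1 : MeasurableSet {q : ℝ × ℝ | √(q.1 ^ 2 + q.2 ^ 2) < 1} :=
    measurableSet_lt (by fun_prop) (by fun_prop)
  have h2 : MeasurableSet {q : ℝ × ℝ | Real.cos a * √(q.1 ^ 2 + q.2 ^ 2) ≤ q.1} :=
    measurableSet_le (by fun_prop) (by fun_prop)
  exact measurable_one.indicator (h1.inter h2)

/-- Polar coordinates in the plane of axial distances `q.1` and radial distances `q.2`; the weight
`q.2 ^ (d - 1)` accounts for the sphere of dimension `d - 1` that a point at radial distance `q.2`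
sweeps out when it is rotated about the axis. -/
theorem lintegral_pow_mul_sectorIndicator {d : ℕ} (hd : 0 < d) {a : ℝ} (ha0 : 0 ≤ a)
    (haπ : a ≤ Real.pi) :
    ∫⁻ q : ℝ × ℝ, (Ioi (0 : ℝ)).indicator (fun t ↦ ENNReal.ofReal (t ^ (d - 1))) q.2 *
        sectorIndicator a q =
      (∫⁻ R in Ioi (0 : ℝ), ENNReal.ofReal (R ^ d) * (Iio (1 : ℝ)).indicator 1 R) *
        ENNReal.ofReal (∫ φ in (0 : ℝ)..a, Real.sin φ ^ (d - 1)) := by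
  have hsin : ENNReal.ofReal (∫ φ in (0 : ℝ)..a, Real.sin φ ^ (d - 1)) =
      ∫⁻ φ in Ioo (-Real.pi) Real.pi,
        (Ioc 0 a).indicator (fun φ ↦ ENNReal.ofReal (Real.sin φ ^ (d - 1))) φ := by
    rw [intervalIntegral.integral_of_le ha0, ofReal_integral_eq_lintegral_ofReal
      (by exact (Continuous.intervalIntegrable (by fun_prop) _ _).1)
      (by
        filter_upwards [ae_restrict_mem measurableSet_Ioc] with y hy
        exact pow_nonneg (Real.sin_nonneg_of_nonneg_of_le_pi hy.1.le (hy.2.trans haπ)) _),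
      Measure.restrict_congr_set Ioo_ae_eq_Ioc, lintegral_indicator measurableSet_Ioc,
      Measure.restrict_restrict measurableSet_Ioc, inter_eq_self_of_subset_left]
    exact Ioc_subset_Ioc (by linarith [Real.pi_pos]) haπ
  have hRm : Measurable fun R : ℝ ↦ ENNReal.ofReal (R ^ d) * (Iio (1 : ℝ)).indicator 1 R :=
    .mul (by fun_prop) (measurable_one.indicator measurableSet_Iio)
  have hφm : Measurable fun φ : ℝ ↦
      (Ioc 0 a).indicator (fun φ ↦ ENNReal.ofReal (Real.sin φ ^ (d - 1))) φ :=
    .indicator (by fun_prop) measurableSet_Ioc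
  rw [hsin, ← lintegral_prod_mul hRm.aemeasurable hφm.aemeasurable,
    Measure.prod_restrict, ← Measure.volume_eq_prod, ← lintegral_comp_polarCoord_symm,
    polarCoord_target]
  refine setLIntegral_congr_fun (measurableSet_Ioi.prod measurableSet_Ioo) ?_
  rintro ⟨R, φ⟩ ⟨hR, hφ1, hφ2⟩
  simp only [mem_Ioi] at hR hφ1 hφ2
  have hnorm : √((R * Real.cos φ) ^ 2 + (R * Real.sin φ) ^ 2) = R := by
    rw [show (R * Real.cos φ) ^ 2 + (R * Real.sin φ) ^ 2 = R ^ 2 by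
      linear_combination R ^ 2 * Real.sin_sq_add_cos_sq φ, Real.sqrt_sq hR.le]
  simp only [polarCoord_symm_apply, sectorIndicator, indicator_apply, mem_ofPred_eq, hnorm, mem_Ioi,
    mem_Iio, mem_Ioc, mul_pos_iff_of_pos_left hR, smul_eq_mul, Pi.one_apply]
  rcases le_or_gt φ 0 with h0 | h0
  · have : ¬ 0 < Real.sin φ := not_lt.2 (Real.sin_nonpos_of_nonpos_of_neg_pi_le h0 hφ1.le)
    simp [this, not_lt.2 h0]
  · have hs : 0 < Real.sin φ := Real.sin_pos_of_pos_of_lt_pi h0 hφ2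
    have hc : Real.cos a * R ≤ R * Real.cos φ ↔ φ ≤ a := by
      rw [mul_comm, mul_le_mul_iff_right₀ hR]
      exact Real.strictAntiOn_cos.le_iff_ge ⟨ha0, haπ⟩ ⟨h0.le, hφ2.le⟩
    have hp : ENNReal.ofReal R * ENNReal.ofReal ((R * Real.sin φ) ^ (d - 1)) =
        ENNReal.ofReal (R ^ d) * ENNReal.ofReal (Real.sin φ ^ (d - 1)) := by
      rw [← ENNReal.ofReal_mul hR.le, ← ENNReal.ofReal_mul (by positivity), mul_pow, ← mul_assoc,
        mul_pow_sub_one hd.ne']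
    by_cases h1 : R < 1 <;> by_cases h2 : φ ≤ a <;> simp [hs, hc, h0, h1, h2, hp]

/-- The surface measure of a spherical cap of half-angle `a` in dimension `d + 1`: the volume of the
cone over the cap inside the unit ball is computed in spherical coordinates about the origin, and
then in cylindrical coordinates about the axis, where polar coordinates in the half-plane of axial
and radial distances apply. -/
theorem toSphere_cap {d : ℕ} (hd : 0 < d) {v : EuclideanSpace ℝ (Fin (d + 1))} (hv : ‖v‖ = 1)
    {a : ℝ} (ha0 : 0 ≤ a) (haπ : a ≤ Real.pi) :
    (volume : Measure (EuclideanSpace ℝ (Fin (d + 1)))).toSphere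
        {ω | Real.cos a ≤ inner ℝ v (ω : EuclideanSpace ℝ (Fin (d + 1)))} =
      (volume : Measure (EuclideanSpace ℝ (Fin d))).toSphere univ *
        ENNReal.ofReal (∫ φ in (0 : ℝ)..a, Real.sin φ ^ (d - 1)) := by
  have : Nonempty (Fin d) := ⟨⟨0, hd⟩⟩
  set cap := {ω : sphere (0 : EuclideanSpace ℝ (Fin (d + 1))) 1 |
    Real.cos a ≤ inner ℝ v (ω : EuclideanSpace ℝ (Fin (d + 1)))} with hcap
  have hcapm : MeasurableSet cap :=
    measurableSet_le measurable_const (Measurable.const_inner measurable_subtype_coe)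
  -- the radial factor, common to both computations and cancelled at the end
  set J : ℝ≥0∞ := ∫⁻ R in Ioi (0 : ℝ), ENNReal.ofReal (R ^ d) * (Iio (1 : ℝ)).indicator 1 R with hJ
  have hJ' : J = ∫⁻ R in Ioo (0 : ℝ) 1, ENNReal.ofReal (R ^ d) := by
    rw [hJ, ← Ioi_inter_Iio, inter_comm, ← Measure.restrict_restrict measurableSet_Iio,
      ← lintegral_indicator measurableSet_Iio]
    refine lintegral_congr fun R ↦ ?_
    by_cases h : R ∈ Iio (1 : ℝ) <;> simp [h]
  have hJ0 : J ≠ 0 := by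
    rw [hJ', ← Measure.restrict_congr_set Ioo_ae_eq_Ioc.symm, ← ofReal_integral_eq_lintegral_ofReal,
      ← intervalIntegral.integral_of_le zero_le_one]
    · simp; positivity
    · exact (intervalIntegral.intervalIntegrable_pow _).1
    · filter_upwards [ae_restrict_mem measurableSet_Ioc] with y hy
      exact pow_nonneg hy.1.le _
  have hJt : J ≠ ∞ := by
    rw [hJ']
    refine ne_top_of_le_ne_top (b := ∫⁻ R in Ioo (0 : ℝ) 1, 1) (by simp) ?_
    refine setLIntegral_mono measurable_const fun R hR ↦ ?_
    rw [← ENNReal.ofReal_one]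
    exact ENNReal.ofReal_le_ofReal (pow_le_one₀ hR.1.le hR.2.le)
  -- the indicator of the cone over the cap inside the unit ball
  set K : EuclideanSpace ℝ (Fin (d + 1)) → ℝ≥0∞ := {x : EuclideanSpace ℝ (Fin (d + 1)) |
    ‖x‖ < 1 ∧ Real.cos a * ‖x‖ ≤ inner ℝ v x}.indicator 1 with hK
  have hKm : Measurable K := by
    have h1 : MeasurableSet {x : EuclideanSpace ℝ (Fin (d + 1)) | ‖x‖ < 1} :=
      measurableSet_lt (by fun_prop) (by fun_prop)
    have h2 : MeasurableSet {x : EuclideanSpace ℝ (Fin (d + 1)) |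
      Real.cos a * ‖x‖ ≤ inner ℝ v x} := measurableSet_le (by fun_prop) (by fun_prop)
    exact measurable_one.indicator (h1.inter h2)
  have h1 : ∫⁻ x, K x = (volume : Measure (EuclideanSpace ℝ (Fin (d + 1)))).toSphere cap * J := by
    rw [lintegral_eq_lintegral_Ioi_toSphere _ hKm, hJ, ← lintegral_const_mul' _ _
      (measure_ne_top _ _)]
    refine setLIntegral_congr_fun measurableSet_Ioi fun r (hr : 0 < r) ↦ ?_
    have e : ∀ ω : sphere (0 : EuclideanSpace ℝ (Fin (d + 1))) 1,
        K (r • (ω : EuclideanSpace ℝ (Fin (d + 1)))) =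
          (Iio (1 : ℝ)).indicator 1 r * cap.indicator 1 ω := by
      intro ω
      have hn : ‖(ω : EuclideanSpace ℝ (Fin (d + 1)))‖ = 1 := by simp
      have : Real.cos a * r ≤ r * inner ℝ v (ω : EuclideanSpace ℝ (Fin (d + 1))) ↔
          Real.cos a ≤ inner ℝ v (ω : EuclideanSpace ℝ (Fin (d + 1))) := by
        rw [mul_comm, mul_le_mul_iff_right₀ hr]
      simp only [hK, hcap, indicator_apply, mem_ofPred_eq, norm_smul, hn, inner_smul_right,
        Real.norm_eq_abs, abs_of_pos hr, mul_one, mem_Iio, this, Pi.one_apply]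
      split_ifs <;> simp_all
    simp only [e]
    rw [lintegral_const_mul _ (measurable_one.indicator hcapm), lintegral_indicator_one hcapm,
      finrank_euclideanSpace, Fintype.card_fin, Nat.add_sub_cancel]
    ring
  obtain ⟨T, hT, hT1, hT2⟩ := exists_linear_split v hv
  have h2 : ∫⁻ x, K x = (volume : Measure (EuclideanSpace ℝ (Fin d))).toSphere univ *
      ∫⁻ q : ℝ × ℝ, (Ioi (0 : ℝ)).indicator (fun t ↦ ENNReal.ofReal (t ^ (d - 1))) q.2 *
        sectorIndicator a q := by
    have hGm := measurable_sectorIndicator a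
    have hm : Measurable fun q : ℝ × EuclideanSpace ℝ (Fin d) ↦ sectorIndicator a (q.1, ‖q.2‖) := by
      fun_prop
    have e : ∀ x, K x = sectorIndicator a ((T x).1, ‖(T x).2‖) := by
      intro x
      have hx : √((T x).1 ^ 2 + ‖(T x).2‖ ^ 2) = ‖x‖ := by
        rw [← real_inner_self_eq_norm_sq, sq, ← hT2, real_inner_self_eq_norm_sq,
          Real.sqrt_sq (norm_nonneg _)]
      simp only [sectorIndicator, indicator_apply, mem_ofPred_eq, hx, hK]
      rw [hT1]
      rfl
    simp only [e]
    rw [hT.lintegral_comp hm, lintegral_prod _ hm.aemeasurable, Measure.volume_eq_prod,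
      lintegral_prod _ (by
        refine Measurable.aemeasurable (.mul ?_ hGm)
        exact ((by fun_prop : Measurable fun t : ℝ ↦ ENNReal.ofReal (t ^ (d - 1))).indicator
          measurableSet_Ioi).comp measurable_snd), ← lintegral_const_mul' _ _ (measure_ne_top _ _)]
    refine lintegral_congr fun x ↦ ?_
    rw [lintegral_eq_lintegral_Ioi_toSphere volume (f := fun w ↦ sectorIndicator a (x, ‖w‖))
      (by fun_prop), ← lintegral_const_mul' _ _ (measure_ne_top _ _),
      ← lintegral_indicator measurableSet_Ioi]
    refine lintegral_congr fun r ↦ ?_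
    by_cases hr : r ∈ Ioi (0 : ℝ)
    · simp [indicator_of_mem hr, norm_smul, abs_of_pos (mem_Ioi.1 hr)]
      ring
    · simp [indicator_of_notMem hr]
  rw [h2, lintegral_pow_mul_sectorIndicator hd ha0 haπ, mul_left_comm, mul_comm J] at h1
  exact ((ENNReal.mul_left_inj hJ0 hJt).1 h1).symm

/-! ### The splitting of the Gaussian noise -/

theorem g_eq_gaussianPDFReal {σ : ℝ} (hσ : 0 < σ) (z : ℝ) :
    g σ z = gaussianPDFReal 0 (σ ^ 2).toNNReal z := by
  rw [g, gaussianPDFReal, Real.coe_toNNReal _ (sq_nonneg σ),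
    Real.sqrt_mul (by positivity : 0 ≤ 2 * Real.pi), Real.sqrt_sq hσ.le, sub_zero, one_div]

theorem g_nonneg {σ : ℝ} (hσ : 0 < σ) (z : ℝ) : 0 ≤ g σ z := by
  rw [g]; positivity

theorem gs_nonneg {n : ℕ} (hn : 2 ≤ n) {σ : ℝ} (hσ : 0 < σ) {r : ℝ} (hr : 0 ≤ r) :
    0 ≤ gs n σ r := by
  have hn' : (2 : ℝ) ≤ n := by exact_mod_cast hn
  have := Real.Gamma_pos_of_pos (s := ((n : ℝ) - 1) / 2) (by linarith)
  rw [gs]; positivity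

theorem measurable_g (σ : ℝ) : Measurable (g σ) := by unfold g; fun_prop

theorem measurable_gs (n : ℕ) (σ : ℝ) : Measurable (gs n σ) := by unfold gs; fun_prop

theorem lintegral_g {σ : ℝ} (hσ : 0 < σ) : ∫⁻ z, ENNReal.ofReal (g σ z) = 1 := by
  simp only [g_eq_gaussianPDFReal hσ]
  exact lintegral_gaussianPDFReal_eq_one 0 (by simp [hσ.ne'])

theorem awgnNoise_eq_withDensity (n : ℕ) {σ : ℝ} (hσ : 0 < σ) :
    awgnNoise n σ = (volume : Measure (EuclideanSpace ℝ (Fin n))).withDensity fun x ↦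
      ENNReal.ofReal ((√(2 * Real.pi) * σ)⁻¹ ^ n * Real.exp (-‖x‖ ^ 2 / (2 * σ ^ 2))) := by
  have hv : (σ ^ 2).toNNReal ≠ 0 := by simp [hσ.ne']
  have hσf : SigmaFinite ((volume : Measure ℝ).withDensity (gaussianPDF 0 (σ ^ 2).toNNReal)) := by
    rw [← gaussianReal_of_var_ne_zero 0 hv]; infer_instance
  rw [awgnNoise, gaussianReal_of_var_ne_zero 0 hv, pi_withDensity _ (measurable_gaussianPDF _ _)]
  have hd : ∀ x : Fin n → ℝ, ∏ i, gaussianPDF 0 (σ ^ 2).toNNReal (x i) =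
      ENNReal.ofReal ((√(2 * Real.pi) * σ)⁻¹ ^ n *
        Real.exp (-‖WithLp.toLp 2 x‖ ^ 2 / (2 * σ ^ 2))) := by
    intro x
    simp only [gaussianPDF, ← g_eq_gaussianPDFReal hσ]
    rw [← ENNReal.ofReal_prod_of_nonneg fun i _ ↦ g_nonneg hσ _]
    simp only [g, one_div]
    rw [Finset.prod_mul_distrib, Finset.prod_const, ← Real.exp_sum, Finset.card_univ,
      Fintype.card_fin, EuclideanSpace.real_norm_sq_eq, ← Finset.sum_div, Finset.sum_neg_distrib]
  ext S hS
  rw [Measure.map_apply (WithLp.measurable_toLp 2 _) hS, withDensity_apply _ hS,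
    withDensity_apply _ (WithLp.measurable_toLp 2 _ hS),
    ← (PiLp.volume_preserving_toLp (Fin n)).setLIntegral_comp_preimage hS (by fun_prop)]
  simp only [hd]

/-- The radial component `z` of the noise, the norm `r` of its tangential component, and the
direction of the latter are independent; `z` and `r` have the densities `g` and `gs`, and the direction is
uniform on the unit sphere. -/
theorem awgnNoise_apply_preimage {m : ℕ} (hm : 0 < m) {σ : ℝ} (hσ : 0 < σ)
    {T : EuclideanSpace ℝ (Fin (m + 1)) →ₗ[ℝ] ℝ × EuclideanSpace ℝ (Fin m)}
    (hT : MeasurePreserving T volume (volume.prod volume))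
    (hT2 : ∀ x y, inner ℝ x y = (T x).1 * (T y).1 + inner ℝ (T x).2 (T y).2)
    {S : Set (ℝ × EuclideanSpace ℝ (Fin m))} (hS : MeasurableSet S) :
    awgnNoise (m + 1) σ (T ⁻¹' S) =
      ∫⁻ z, ENNReal.ofReal (g σ z) * ∫⁻ r in Ioi (0 : ℝ), ENNReal.ofReal (gs (m + 1) σ r) *
        (((volume : Measure (EuclideanSpace ℝ (Fin m))).toSphere univ)⁻¹ *
          (volume : Measure (EuclideanSpace ℝ (Fin m))).toSphere
            {ω | (z, r • (ω : EuclideanSpace ℝ (Fin m))) ∈ S}) := by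
  have : Nonempty (Fin m) := ⟨⟨0, hm⟩⟩
  set c : ℝ := (√(2 * Real.pi) * σ)⁻¹ ^ (m + 1) with hc
  have hSi : Measurable (S.indicator (1 : ℝ × EuclideanSpace ℝ (Fin m) → ℝ≥0∞)) :=
    measurable_one.indicator hS
  set F : ℝ × EuclideanSpace ℝ (Fin m) → ℝ≥0∞ := fun q ↦
    ENNReal.ofReal (c * Real.exp (-(q.1 ^ 2 + ‖q.2‖ ^ 2) / (2 * σ ^ 2))) * S.indicator 1 q with hF
  have hFm : Measurable F := .mul (by fun_prop) hSi
  have h1 : awgnNoise (m + 1) σ (T ⁻¹' S) = ∫⁻ x, F (T x) := by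
    rw [awgnNoise_eq_withDensity _ hσ, withDensity_apply _ (hT.measurable hS),
      ← lintegral_indicator (hT.measurable hS)]
    refine lintegral_congr fun x ↦ ?_
    have hx : ‖x‖ ^ 2 = (T x).1 ^ 2 + ‖(T x).2‖ ^ 2 := by
      rw [← real_inner_self_eq_norm_sq, ← real_inner_self_eq_norm_sq, hT2, sq]
    by_cases h : T x ∈ S
    · rw [indicator_of_mem (mem_preimage.2 h), hx]
      simp [hF, hc, h]
    · rw [indicator_of_notMem (by simpa using h)]
      simp [hF, h]
  rw [h1, hT.lintegral_comp hFm, lintegral_prod _ hFm.aemeasurable]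
  refine lintegral_congr fun z ↦ ?_
  rw [lintegral_eq_lintegral_Ioi_toSphere volume (f := fun w ↦ F (z, w)) (by fun_prop),
    ← lintegral_const_mul' _ _ ENNReal.ofReal_ne_top]
  refine setLIntegral_congr_fun measurableSet_Ioi fun r (hr : 0 < r) ↦ ?_
  have hSm : MeasurableSet {ω : sphere (0 : EuclideanSpace ℝ (Fin m)) 1 |
      (z, r • (ω : EuclideanSpace ℝ (Fin m))) ∈ S} :=
    (by fun_prop : Measurable fun ω : sphere (0 : EuclideanSpace ℝ (Fin m)) 1 ↦
      (z, r • (ω : EuclideanSpace ℝ (Fin m)))) hS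
  have e : ∀ ω : sphere (0 : EuclideanSpace ℝ (Fin m)) 1,
      F (z, r • (ω : EuclideanSpace ℝ (Fin m))) =
        ENNReal.ofReal (c * Real.exp (-(z ^ 2 + r ^ 2) / (2 * σ ^ 2))) *
        {ω : sphere (0 : EuclideanSpace ℝ (Fin m)) 1 |
          (z, r • (ω : EuclideanSpace ℝ (Fin m))) ∈ S}.indicator 1 ω := by
    intro ω
    have hn : ‖r • (ω : EuclideanSpace ℝ (Fin m))‖ = r := by
      rw [norm_smul]; simp [abs_of_pos hr]
    simp only [hF, hn]
    rfl
  simp only [e]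
  rw [lintegral_const_mul _ (measurable_one.indicator hSm), lintegral_indicator_one hSm,
    finrank_euclideanSpace, Fintype.card_fin, ← mul_assoc, ← mul_assoc, ← mul_assoc]
  congr 1
  have hm' : (0 : ℝ) < m := by exact_mod_cast hm
  have hΓ := Real.Gamma_pos_of_pos (half_pos hm')
  have hg := g_nonneg hσ z
  have hgs := gs_nonneg (n := m + 1) (by lia) hσ hr.le
  have hpi := Real.pi_pos
  rw [toSphere_volume_univ hm, ← ENNReal.ofReal_inv_of_pos (by positivity),
    ← ENNReal.ofReal_mul (by positivity), ← ENNReal.ofReal_mul hg,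
    ← ENNReal.ofReal_mul (by positivity)]
  congr 1
  have h2 : (2 : ℝ) ^ ((m : ℝ) / 2) = √2 ^ m := by
    rw [Real.sqrt_eq_rpow, ← Real.rpow_natCast, ← Real.rpow_mul zero_le_two]
    congr 1; ring
  have hexp : Real.exp (-(z ^ 2 + r ^ 2) / (2 * σ ^ 2)) =
      Real.exp (-z ^ 2 / (2 * σ ^ 2)) * Real.exp (-r ^ 2 / (2 * σ ^ 2)) := by
    rw [← Real.exp_add]; congr 1; ring
  rw [g, gs, hc, hexp, Real.sqrt_mul zero_le_two]
  simp only [Nat.cast_add, Nat.cast_one, add_sub_cancel_right, h2,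
    show m + 1 - 2 = m - 1 by lia, Nat.add_sub_cancel, inv_pow, mul_pow, pow_succ]
  have h3 : √2 ≠ 0 := by positivity
  have h4 : √Real.pi ≠ 0 := by positivity
  field_simp

/-- That `gs` is a probability density follows from the splitting of the noise applied to the whole
space. -/
theorem lintegral_gs {n : ℕ} (hn : 2 ≤ n) {σ : ℝ} (hσ : 0 < σ) :
    ∫⁻ r in Ioi (0 : ℝ), ENNReal.ofReal (gs n σ r) = 1 := by
  obtain ⟨m, rfl⟩ : ∃ m, n = m + 1 := ⟨n - 1, by lia⟩
  have hm : 0 < m := by lia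
  have : Nonempty (Fin m) := ⟨⟨0, hm⟩⟩
  obtain ⟨T, hT, -, hT2⟩ := exists_linear_split (EuclideanSpace.single (0 : Fin (m + 1)) (1 : ℝ))
    (by simp)
  have h := awgnNoise_apply_preimage hm hσ hT hT2 MeasurableSet.univ
  have hA := toSphere_volume_univ_ne_zero hm
  have hP : awgnNoise (m + 1) σ univ = 1 := by
    rw [awgnNoise, Measure.map_apply (WithLp.measurable_toLp 2 _) .univ]
    simp
  simp only [preimage_univ, mem_univ, ofPred_true, ENNReal.inv_mul_cancel hA (measure_ne_top _ _),
    mul_one] at h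
  rw [lintegral_mul_const _ (measurable_g σ).ennreal_ofReal, lintegral_g hσ, one_mul, hP] at h
  exact h.symm

/-! ### The fraction of the sphere covered by a cap -/

theorem capFraction_nonneg {n : ℕ} (hn : 3 ≤ n) {a : ℝ} (ha0 : 0 ≤ a) (haπ : a ≤ Real.pi) :
    0 ≤ capFraction n a := by
  have hn' : (3 : ℝ) ≤ n := by exact_mod_cast hn
  have h1 := Real.Gamma_pos_of_pos (s := ((n : ℝ) - 1) / 2) (by linarith)
  have h2 := Real.Gamma_pos_of_pos (s := ((n : ℝ) - 2) / 2) (by linarith)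
  refine mul_nonneg (by positivity) (intervalIntegral.integral_nonneg ha0 fun φ hφ ↦ ?_)
  exact pow_nonneg (Real.sin_nonneg_of_nonneg_of_le_pi hφ.1 (hφ.2.trans haπ)) _

/-- `capFraction` is normalized by the ratio of the surface areas of the unit spheres in dimensions
`d` and `d + 1`. -/
theorem toSphere_cap_eq_capFraction {d : ℕ} (hd : 0 < d) {v : EuclideanSpace ℝ (Fin (d + 1))}
    (hv : ‖v‖ = 1) {a : ℝ} (ha0 : 0 ≤ a) (haπ : a ≤ Real.pi) :
    (volume : Measure (EuclideanSpace ℝ (Fin (d + 1)))).toSphere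
        {ω | Real.cos a ≤ inner ℝ v (ω : EuclideanSpace ℝ (Fin (d + 1)))} =
      (volume : Measure (EuclideanSpace ℝ (Fin (d + 1)))).toSphere univ *
        ENNReal.ofReal (capFraction (d + 2) a) := by
  have hd' : (0 : ℝ) < d := by exact_mod_cast hd
  have h1 := Real.Gamma_pos_of_pos (half_pos hd')
  have h2 := Real.Gamma_pos_of_pos (s := ((d : ℝ) + 1) / 2) (by linarith)
  have hpi := Real.pi_pos
  rw [toSphere_cap hd hv ha0 haπ, toSphere_volume_univ hd, toSphere_volume_univ d.succ_pos,
    ← ENNReal.ofReal_mul (by positivity), ← ENNReal.ofReal_mul (by positivity), capFraction]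
  congr 1
  push_cast
  rw [show (d : ℝ) + 2 - 1 = d + 1 by ring, show (d : ℝ) + 2 - 2 = d by ring,
    Nat.succ_eq_add_one, pow_succ]
  have h3 : √Real.pi ≠ 0 := by positivity
  field_simp

theorem capFraction_pi {n : ℕ} (hn : 3 ≤ n) : capFraction n Real.pi = 1 := by
  obtain ⟨d, rfl⟩ : ∃ d, n = d + 2 := ⟨n - 2, by lia⟩
  have hd : 0 < d := by lia
  set v : EuclideanSpace ℝ (Fin (d + 1)) := EuclideanSpace.single 0 1
  have hv : ‖v‖ = 1 := by simp [v]
  have h := toSphere_cap_eq_capFraction hd hv Real.pi_pos.le le_rfl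
  have huniv : {ω : sphere (0 : EuclideanSpace ℝ (Fin (d + 1))) 1 |
      Real.cos Real.pi ≤ inner ℝ v (ω : EuclideanSpace ℝ (Fin (d + 1)))} = univ := by
    refine eq_univ_of_forall fun ω ↦ ?_
    have := (abs_le.1 (abs_real_inner_le_norm v (ω : EuclideanSpace ℝ (Fin (d + 1))))).1
    simpa [hv] using this
  have hA := toSphere_volume_univ_ne_zero d.succ_pos
  rw [huniv] at h
  have h' : ENNReal.ofReal (capFraction (d + 2) Real.pi) = 1 :=
    ((ENNReal.mul_right_inj hA (measure_ne_top _ _)).1 ((mul_one _).trans h)).symm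
  simpa using h'

theorem capFraction_pi_sub {n : ℕ} (hn : 3 ≤ n) (a : ℝ) :
    capFraction n (Real.pi - a) = 1 - capFraction n a := by
  have h := intervalIntegral.integral_comp_sub_left (fun φ ↦ Real.sin φ ^ (n - 3)) Real.pi
    (a := a) (b := Real.pi)
  simp only [Real.sin_pi_sub, sub_self] at h
  rw [← capFraction_pi hn]
  simp only [capFraction]
  rw [← h, ← mul_sub, intervalIntegral.integral_interval_sub_left
    (Continuous.intervalIntegrable (by fun_prop) _ _)
    (Continuous.intervalIntegrable (by fun_prop) _ _)]

theorem capFraction_zero (n : ℕ) : capFraction n 0 = 0 := by simp [capFraction]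

/-- Since `Real.arccos` is constant outside `[-1, 1]` and the complement of a cap is the opposite
cap, the four cases in the definition of `pairError` are a single formula. -/
theorem pairError_eq_capFraction {n : ℕ} (hn : 3 ≤ n) {z r δ₁ δ₂ δ : ℝ} (hr : 0 < r)
    (hθ : Real.sin (theta δ₁ δ₂ δ) ≠ 0) :
    pairError n z r δ₁ δ₂ δ = capFraction n (Real.arccos (beta δ₁ δ₂ δ z / r)) := by
  rw [pairError, if_neg hθ]
  set β := beta δ₁ δ₂ δ z
  split_ifs with h1 h2 h2
  · rfl
  · rw [Real.arccos_of_one_le ((one_le_div hr).2 (not_le.1 h2).le), capFraction_zero]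
  · rw [abs_of_nonpos (not_lt.1 h1), neg_div, Real.arccos_neg, capFraction_pi_sub hn,
      sub_sub_cancel]
  · rw [abs_of_nonpos (not_lt.1 h1), not_le] at h2
    rw [Real.arccos_of_le_neg_one (by rw [div_le_iff₀ hr]; linarith), capFraction_pi hn]

theorem pairError_nonneg {n : ℕ} (hn : 3 ≤ n) {r : ℝ} (hr : 0 < r) (z δ₁ δ₂ δ : ℝ) :
    0 ≤ pairError n z r δ₁ δ₂ δ := by
  by_cases hθ : Real.sin (theta δ₁ δ₂ δ) = 0
  · rw [pairError, if_pos hθ]; split_ifs <;> norm_num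
  · rw [pairError_eq_capFraction hn hr hθ]
    exact capFraction_nonneg hn (Real.arccos_nonneg _) (Real.arccos_le_pi _)

theorem measurable_capFraction (n : ℕ) : Measurable (capFraction n) := by
  refine Measurable.const_mul (Continuous.measurable ?_) _
  exact intervalIntegral.continuous_primitive
    (fun a b ↦ Continuous.intervalIntegrable (by fun_prop) a b) 0

theorem measurable_pairError (n : ℕ) (δ₁ δ₂ δ : ℝ) :
    Measurable fun q : ℝ × ℝ ↦ pairError n q.1 q.2 δ₁ δ₂ δ := by
  have hβ : Measurable fun q : ℝ × ℝ ↦ beta δ₁ δ₂ δ q.1 := by unfold beta; fun_prop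
  have hc := measurable_capFraction n
  have hacos : Measurable Real.arccos := Real.continuous_arccos.measurable
  unfold pairError
  by_cases hθ : Real.sin (theta δ₁ δ₂ δ) = 0
  · simp only [hθ, if_true]
    exact .ite (measurableSet_lt (by fun_prop) (by fun_prop)) measurable_const measurable_const
  · simp only [hθ, if_false]
    refine .ite (measurableSet_lt measurable_const hβ)
      (.ite (measurableSet_le hβ measurable_snd) ?_ measurable_const)
      (.ite (measurableSet_le (by simpa [Real.norm_eq_abs] using hβ.norm) measurable_snd) ?_
        measurable_const)
    · exact hc.comp (hacos.comp (hβ.div measurable_snd))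
    · refine (hc.comp (hacos.comp (Measurable.div ?_ measurable_snd))).const_sub 1
      simpa [Real.norm_eq_abs] using hβ.norm

/-! ### Pairwise errors -/

/-- `theta` is the angle at `s` between the direction of the origin and the direction of `t`. -/
theorem mul_cos_theta {E : Type*} [NormedAddCommGroup E] [InnerProductSpace ℝ E] {s t : E}
    (hs : s ≠ 0) (hst : s ≠ t) :
    dist s t * Real.cos (theta ‖s‖ ‖t‖ (dist s t)) = inner ℝ (-(‖s‖⁻¹ • s)) (t - s) := by
  have hs' : 0 < ‖s‖ := norm_pos_iff.2 hs
  have hδ : 0 < dist s t := dist_pos.2 hst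
  have hin : (‖s‖ ^ 2 + dist s t ^ 2 - ‖t‖ ^ 2) / 2 = - inner ℝ s (t - s) := by
    have h := norm_add_sq_real s (t - s)
    rw [add_sub_cancel] at h
    rw [dist_comm, dist_eq_norm]
    linarith
  have hq : (‖s‖ ^ 2 + dist s t ^ 2 - ‖t‖ ^ 2) / (2 * ‖s‖ * dist s t) =
      - inner ℝ s (t - s) / (‖s‖ * dist s t) := by
    rw [← hin]; field_simp
  have hb := abs_le.1 (abs_real_inner_le_norm s (t - s))
  rw [← dist_eq_norm, dist_comm t s] at hb
  rw [theta, hq, Real.cos_arccos, inner_neg_left, inner_smul_left]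
  · simp; field_simp
  · rw [le_div_iff₀ (by positivity)]; linarith
  · rw [div_le_iff₀ (by positivity)]; linarith

/-- Conditionally on the radial noise component `z` and the norm `r` of the tangential noise, the
direction of the latter lies in a spherical cap whenever `t` is at least as close to the received
vector as the transmitted `s`. -/
theorem toSphere_pairwise_le_pairError {d : ℕ} (hd : 0 < d)
    {s t : EuclideanSpace ℝ (Fin (d + 2))} (hs : s ≠ 0) (hst : s ≠ t)
    {T : EuclideanSpace ℝ (Fin (d + 2)) →ₗ[ℝ] ℝ × EuclideanSpace ℝ (Fin (d + 1))}
    (hT1 : ∀ x, (T x).1 = inner ℝ (-(‖s‖⁻¹ • s)) x)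
    (hT2 : ∀ x y, inner ℝ x y = (T x).1 * (T y).1 + inner ℝ (T x).2 (T y).2)
    (z : ℝ) {r : ℝ} (hr : 0 < r) :
    (volume : Measure (EuclideanSpace ℝ (Fin (d + 1)))).toSphere
        {ω | dist s t ^ 2 / 2 ≤ (T (t - s)).1 * z +
          inner ℝ (T (t - s)).2 (r • (ω : EuclideanSpace ℝ (Fin (d + 1))))} ≤
      (volume : Measure (EuclideanSpace ℝ (Fin (d + 1)))).toSphere univ *
        ENNReal.ofReal (pairError (d + 2) z r ‖s‖ ‖t‖ (dist s t)) := by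
  set δ := dist s t with hδd
  set θ := theta ‖s‖ ‖t‖ δ with hθ
  set w := (T (t - s)).2 with hw
  have hδ : 0 < δ := dist_pos.2 hst
  have hcos : (T (t - s)).1 = δ * Real.cos θ := by rw [hT1, mul_cos_theta hs hst]
  have hsin0 : 0 ≤ Real.sin θ :=
    Real.sin_nonneg_of_nonneg_of_le_pi (Real.arccos_nonneg _) (Real.arccos_le_pi _)
  have hwn : ‖w‖ = δ * Real.sin θ := by
    have h := hT2 (t - s) (t - s)
    rw [real_inner_self_eq_norm_sq, real_inner_self_eq_norm_sq, ← hw, hcos, ← dist_eq_norm,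
      dist_comm, ← hδd] at h
    refine (sq_eq_sq₀ (norm_nonneg _) (by positivity)).1 ?_
    linear_combination -h - δ ^ 2 * Real.sin_sq_add_cos_sq θ
  rw [hcos]
  by_cases h0 : Real.sin θ = 0
  -- `t - s` is parallel to `s`, so that the event depends on `z` alone
  · have hw0 : w = 0 := by rw [← norm_eq_zero, hwn, h0, mul_zero]
    simp only [hw0, inner_zero_left, add_zero, pairError, ← hθ, h0, if_true]
    split_ifs with h
    · have : ¬ δ ^ 2 / 2 ≤ δ * Real.cos θ * z := by
        have := mul_pos hδ h
        rw [not_le]; linarith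
      simp [this]
    · rw [ENNReal.ofReal_one, mul_one]
      exact measure_mono (subset_univ _)
  · have hsin : 0 < Real.sin θ := lt_of_le_of_ne hsin0 (Ne.symm h0)
    have hwp : 0 < ‖w‖ := by rw [hwn]; positivity
    rw [pairError_eq_capFraction (by lia) hr h0, ← toSphere_cap_eq_capFraction hd
      (v := ‖w‖⁻¹ • w) (by rw [norm_smul, norm_inv, norm_norm, inv_mul_cancel₀ hwp.ne'])
      (Real.arccos_nonneg _) (Real.arccos_le_pi _)]
    refine measure_mono fun ω hω ↦ ?_
    rw [mem_ofPred_eq, inner_smul_right] at hω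
    set x := inner ℝ (‖w‖⁻¹ • w) (ω : EuclideanSpace ℝ (Fin (d + 1))) with hx
    have hxw : inner ℝ w (ω : EuclideanSpace ℝ (Fin (d + 1))) = δ * Real.sin θ * x := by
      rw [hx, inner_smul_left, ← hwn]
      simp; field_simp
    have hxa : |x| ≤ 1 := by
      refine (abs_real_inner_le_norm _ _).trans ?_
      rw [norm_smul, norm_inv, norm_norm, inv_mul_cancel₀ hwp.ne']
      simp
    have hβx : beta ‖s‖ ‖t‖ δ z / r ≤ x := by
      rw [hxw] at hω
      rw [beta, ← hθ, div_le_iff₀ hr, div_le_iff₀ (by positivity)]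
      refine le_of_mul_le_mul_left ?_ hδ
      linarith
    change Real.cos _ ≤ x
    rw [← Real.cos_arccos (abs_le.1 hxa).1 (abs_le.1 hxa).2]
    exact Real.cos_le_cos_of_nonneg_of_le_pi (Real.arccos_nonneg _) (Real.arccos_le_pi _)
      (Real.antitone_arccos hβx)

/-! ### Maximum-likelihood decoding is minimum-distance decoding -/

theorem likelihood_eq {n : ℕ} {σ : ℝ} (hσ : 0 < σ) (s y : EuclideanSpace ℝ (Fin n)) :
    likelihood σ s y =
      (√(2 * Real.pi) * σ)⁻¹ ^ n * Real.exp (-‖y - s‖ ^ 2 / (2 * σ ^ 2)) := by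
  have h : ∀ i, gaussianPDFReal (s i) (σ ^ 2).toNNReal (y i) = g σ (y i - s i) := by
    intro i
    rw [g_eq_gaussianPDFReal hσ, gaussianPDFReal, gaussianPDFReal, sub_zero]
  simp only [likelihood, h, g, one_div]
  rw [Finset.prod_mul_distrib, Finset.prod_const, ← Real.exp_sum, Finset.card_univ,
    Fintype.card_fin, EuclideanSpace.real_norm_sq_eq, ← Finset.sum_div, Finset.sum_neg_distrib]
  rfl

theorem likelihood_le_likelihood_iff {n : ℕ} {σ : ℝ} (hσ : 0 < σ)
    (s t y : EuclideanSpace ℝ (Fin n)) :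
    likelihood σ s y ≤ likelihood σ t y ↔ ‖y - t‖ ≤ ‖y - s‖ := by
  rw [likelihood_eq hσ, likelihood_eq hσ, mul_le_mul_iff_right₀ (by positivity),
    Real.exp_le_exp, div_le_div_iff_of_pos_right (by positivity), neg_le_neg_iff,
    sq_le_sq₀ (norm_nonneg _) (norm_nonneg _)]

theorem norm_add_sub_le_norm_iff {E : Type*} [NormedAddCommGroup E] [InnerProductSpace ℝ E]
    (s t x : E) : ‖s + x - t‖ ≤ ‖s + x - s‖ ↔ dist s t ^ 2 / 2 ≤ inner ℝ (t - s) x := by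
  rw [add_sub_cancel_left, ← sq_le_sq₀ (norm_nonneg _) (norm_nonneg _), dist_comm, dist_eq_norm,
    show s + x - t = x - (t - s) by abel, norm_sub_sq_real, real_inner_comm]
  constructor <;> intro h <;> linarith

/-! ### The union bound and the triangle spectrum -/

/-- The union bound on the error probability of the codeword `s`, given the radial noise component
`z` and the norm `r` of the tangential noise. -/
noncomputable def condUnionBound {n : ℕ} (C : Finset (EuclideanSpace ℝ (Fin n)))
    (s : EuclideanSpace ℝ (Fin n)) (z r : ℝ) : ℝ :=
  ∑ t ∈ C with 0 < dist s t, pairError n z r ‖s‖ ‖t‖ (dist s t)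

theorem condUnionBound_nonneg {n : ℕ} (hn : 3 ≤ n) (C : Finset (EuclideanSpace ℝ (Fin n)))
    (s : EuclideanSpace ℝ (Fin n)) (z : ℝ) {r : ℝ} (hr : 0 < r) : 0 ≤ condUnionBound C s z r :=
  Finset.sum_nonneg fun _ _ ↦ pairError_nonneg hn hr _ _ _ _

theorem measurable_condUnionBound {n : ℕ} (C : Finset (EuclideanSpace ℝ (Fin n)))
    (s : EuclideanSpace ℝ (Fin n)) : Measurable fun q : ℝ × ℝ ↦ condUnionBound C s q.1 q.2 :=
  Finset.measurable_sum _ fun _ _ ↦ measurable_pairError _ _ _ _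

theorem dist_mem_distValues {n : ℕ} {C : Finset (EuclideanSpace ℝ (Fin n))}
    {s t : EuclideanSpace ℝ (Fin n)} (hs : s ∈ C) (ht : t ∈ C) :
    dist s t ∈ distValues C ↔ 0 < dist s t := by
  simp only [distValues, Finset.mem_filter, Finset.mem_image, and_iff_right_iff_imp]
  exact fun _ ↦ ⟨(s, t), Finset.mem_product.2 ⟨hs, ht⟩, rfl⟩

/-- Summing over the triangle spectrum amounts to summing over ordered pairs of distinct codewords:
`f_s` is the average of the conditional union bounds. -/
theorem fs_eq_sum_condUnionBound {n : ℕ} (C : Finset (EuclideanSpace ℝ (Fin n))) (z r : ℝ) :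
    fs C z r = ∑ s ∈ C, 1 / (C.card : ℝ) * condUnionBound C s z r := by
  have swap : ∀ F : EuclideanSpace ℝ (Fin n) → ℝ → ℝ → ℝ → ℝ,
      ∑ δ₁ ∈ normValues C, ∑ δ₂ ∈ normValues C, ∑ δ ∈ distValues C, ∑ s ∈ C, F s δ₁ δ₂ δ =
      ∑ s ∈ C, ∑ δ₁ ∈ normValues C, ∑ δ₂ ∈ normValues C, ∑ δ ∈ distValues C, F s δ₁ δ₂ δ := by
    intro F
    simp only [Finset.sum_comm (s := distValues C) (t := C)]
    simp only [Finset.sum_comm (s := normValues C) (t := C)]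
  have key : ∀ s ∈ C, ∑ δ₁ ∈ normValues C, ∑ δ₂ ∈ normValues C, ∑ δ ∈ distValues C,
      condTriangleSpectrum C s δ₁ δ₂ δ * pairError n z r δ₁ δ₂ δ = condUnionBound C s z r := by
    intro s hs
    have hmem : ∀ t ∈ C, ‖t‖ ∈ normValues C := fun t ht ↦ Finset.mem_image_of_mem _ ht
    have hterm : ∀ δ₁ δ₂ δ, condTriangleSpectrum C s δ₁ δ₂ δ * pairError n z r δ₁ δ₂ δ =
        ∑ t ∈ C, if ‖s‖ = δ₁ then if ‖t‖ = δ₂ then if dist s t = δ then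
          pairError n z r δ₁ δ₂ δ else 0 else 0 else 0 := by
      intro δ₁ δ₂ δ
      rw [condTriangleSpectrum]
      split_ifs
      · rw [Finset.card_filter, Nat.cast_sum, Finset.sum_mul]
        refine Finset.sum_congr rfl fun t _ ↦ ?_
        by_cases h1 : ‖t‖ = δ₂ <;> by_cases h2 : dist s t = δ <;> simp [h1, h2]
      · simp
    simp only [hterm]
    rw [swap, condUnionBound, Finset.sum_filter]
    refine Finset.sum_congr rfl fun t ht ↦ ?_
    rw [Finset.sum_eq_single_of_mem _ (hmem s hs) (by
      intro δ₁ _ h; simp [h.symm]), Finset.sum_eq_single_of_mem _ (hmem t ht) (by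
      intro δ₂ _ h; simp [h.symm])]
    simp [dist_mem_distValues hs ht]
  simp only [fs, triangleSpectrum, Finset.sum_mul]
  rw [swap]
  refine Finset.sum_congr rfl fun s hs ↦ ?_
  rw [← key s hs]
  simp only [Finset.mul_sum, mul_assoc]

/-- Given `z` and `r`, the probability of error of the codeword `s` is at most its union bound, and
at most `1`. -/
theorem awgnNoise_error_le {n : ℕ} (hn : 3 ≤ n) {σ : ℝ} (hσ : 0 < σ)
    {C : Finset (EuclideanSpace ℝ (Fin n))}
    {D : EuclideanSpace ℝ (Fin n) → EuclideanSpace ℝ (Fin n)} (hD : IsMLDecoder σ C D)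
    {s : EuclideanSpace ℝ (Fin n)} (hs : s ∈ C) (hs0 : s ≠ 0) :
    awgnNoise n σ {x | D (s + x) ≠ s} ≤
      ∫⁻ z, ENNReal.ofReal (g σ z) * ∫⁻ r in Ioi (0 : ℝ), ENNReal.ofReal (gs n σ r) *
        ENNReal.ofReal (min (condUnionBound C s z r) 1) := by
  obtain ⟨d, rfl⟩ : ∃ d, n = d + 2 := ⟨n - 2, by lia⟩
  have hd : 0 < d := by lia
  have hu : ‖-(‖s‖⁻¹ • s)‖ = 1 := by
    rw [norm_neg, norm_smul, norm_inv, norm_norm, inv_mul_cancel₀ (norm_ne_zero_iff.2 hs0)]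
  obtain ⟨T, hT, hT1, hT2⟩ := exists_linear_split _ hu
  set I := C.filter fun t ↦ 0 < dist s t with hI
  set S : Set (ℝ × EuclideanSpace ℝ (Fin (d + 1))) := ⋃ t ∈ I,
    {q | dist s t ^ 2 / 2 ≤ (T (t - s)).1 * q.1 + inner ℝ (T (t - s)).2 q.2} with hS
  have hSm : MeasurableSet S :=
    .biUnion I.countable_toSet fun t _ ↦ measurableSet_le (by fun_prop) (by fun_prop)
  -- the error event is contained in a measurable one, so that `D` itself need not be measurable
  have hsub : {x | D (s + x) ≠ s} ⊆ T ⁻¹' S := by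
    intro x hx
    have ht := hD (s + x)
    simp only [hS, mem_preimage, mem_iUnion, mem_ofPred_eq, hI, Finset.mem_filter]
    refine ⟨D (s + x), ⟨ht.1, dist_pos.2 (Ne.symm hx)⟩, ?_⟩
    rw [← hT2, ← norm_add_sub_le_norm_iff, ← likelihood_le_likelihood_iff hσ]
    exact ht.2 s hs
  refine (measure_mono hsub).trans ?_
  rw [awgnNoise_apply_preimage d.succ_pos hσ hT hT2 hSm]
  refine lintegral_mono fun z ↦ mul_le_mul_right (setLIntegral_mono' measurableSet_Ioi
    fun r (hr : 0 < r) ↦ mul_le_mul_right ?_ _) _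
  set A := (volume : Measure (EuclideanSpace ℝ (Fin (d + 1)))).toSphere univ with hA
  have hA0 : A ≠ 0 := toSphere_volume_univ_ne_zero d.succ_pos
  have hAt : A ≠ ∞ := measure_ne_top _ _
  rw [ENNReal.inv_mul_le_iff hA0 hAt, ENNReal.ofReal_min]
  rcases min_choice (ENNReal.ofReal (condUnionBound C s z r)) (ENNReal.ofReal 1) with h | h
  · rw [h, condUnionBound, ENNReal.ofReal_sum_of_nonneg fun t _ ↦
      pairError_nonneg hn hr _ _ _ _, Finset.mul_sum]
    have hU : {ω : sphere (0 : EuclideanSpace ℝ (Fin (d + 1))) 1 |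
        (z, r • (ω : EuclideanSpace ℝ (Fin (d + 1)))) ∈ S} = ⋃ t ∈ I,
        {ω : sphere (0 : EuclideanSpace ℝ (Fin (d + 1))) 1 | dist s t ^ 2 / 2 ≤
          (T (t - s)).1 * z +
            inner ℝ (T (t - s)).2 (r • (ω : EuclideanSpace ℝ (Fin (d + 1))))} := by
      ext ω
      simp only [hS, mem_iUnion, mem_ofPred_eq]
    rw [hU]
    refine (measure_biUnion_finset_le _ _).trans (Finset.sum_le_sum fun t ht ↦ ?_)
    exact toSphere_pairwise_le_pairError hd hs0 (dist_pos.1 (Finset.mem_filter.1 ht).2) hT1 hT2 z hr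
  · rw [h, ENNReal.ofReal_one, mul_one]
    exact measure_mono (subset_univ _)

/-! ### Averaging over the codewords -/

theorem measurable_fs {n : ℕ} (C : Finset (EuclideanSpace ℝ (Fin n))) :
    Measurable fun q : ℝ × ℝ ↦ fs C q.1 q.2 := by
  simp only [fs_eq_sum_condUnionBound]
  exact Finset.measurable_sum _ fun s _ ↦ (measurable_condUnionBound C s).const_mul _

/-- Truncation at `1` is concave, so it may be moved outside the average over the codewords. -/
theorem sum_min_condUnionBound_le {n : ℕ} {C : Finset (EuclideanSpace ℝ (Fin n))}
    (hC : C.Nonempty) (z r : ℝ) :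
    ∑ s ∈ C, 1 / (C.card : ℝ) * min (condUnionBound C s z r) 1 ≤ min (fs C z r) 1 := by
  have hM : (0 : ℝ) < C.card := by exact_mod_cast hC.card_pos
  rw [fs_eq_sum_condUnionBound]
  refine le_min (Finset.sum_le_sum fun s _ ↦ ?_) ?_
  · gcongr; exact min_le_left _ _
  · calc _ ≤ ∑ s ∈ C, 1 / (C.card : ℝ) * 1 := by
          refine Finset.sum_le_sum fun s _ ↦ ?_
          gcongr; exact min_le_right _ _
      _ = 1 := by simp [hM.ne']

theorem ofReal_errorProb_le {n : ℕ} (hn : 3 ≤ n) {σ : ℝ} (hσ : 0 < σ)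
    {C : Finset (EuclideanSpace ℝ (Fin n))} (hC : ∀ s ∈ C, s ≠ 0)
    {D : EuclideanSpace ℝ (Fin n) → EuclideanSpace ℝ (Fin n)} (hD : IsMLDecoder σ C D) :
    ENNReal.ofReal (errorProb σ C D) ≤
      ∫⁻ z, ENNReal.ofReal (g σ z) * ∫⁻ r in Ioi (0 : ℝ), ENNReal.ofReal (gs n σ r) *
        ENNReal.ofReal (min (fs C z r) 1) := by
  have hM0 : 0 ≤ 1 / (C.card : ℝ) := by positivity
  have hgm := (measurable_g σ).ennreal_ofReal
  have hgsm := (measurable_gs n σ).ennreal_ofReal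
  set V : EuclideanSpace ℝ (Fin n) → ℝ → ℝ → ℝ≥0∞ := fun s z r ↦ ENNReal.ofReal (gs n σ r) *
    ENNReal.ofReal (min (condUnionBound C s z r) 1) with hV
  have hVm : ∀ s, Measurable fun q : ℝ × ℝ ↦ V s q.1 q.2 := fun s ↦
    (hgsm.comp measurable_snd).mul
      ((measurable_condUnionBound C s).min measurable_const).ennreal_ofReal
  have hIm : ∀ s, Measurable fun z ↦ ∫⁻ r in Ioi (0 : ℝ), V s z r := fun s ↦
    (hVm s).lintegral_prod_right'
  calc ENNReal.ofReal (errorProb σ C D)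
      ≤ ∑ s ∈ C, ENNReal.ofReal (1 / (C.card : ℝ)) * awgnNoise n σ {x | D (s + x) ≠ s} := by
        simp only [errorProb, condErrorProb]
        rw [ENNReal.ofReal_sum_of_nonneg fun s _ ↦ mul_nonneg hM0 measureReal_nonneg]
        refine Finset.sum_le_sum fun s _ ↦ ?_
        rw [ENNReal.ofReal_mul hM0]
        exact mul_le_mul_right ENNReal.ofReal_toReal_le _
    _ ≤ ∑ s ∈ C, ENNReal.ofReal (1 / (C.card : ℝ)) * ∫⁻ z, ENNReal.ofReal (g σ z) *
          ∫⁻ r in Ioi (0 : ℝ), V s z r :=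
        Finset.sum_le_sum fun s hs ↦ mul_le_mul_right (awgnNoise_error_le hn hσ hD hs (hC s hs)) _
    _ = ∫⁻ z, ∑ s ∈ C, ENNReal.ofReal (1 / (C.card : ℝ)) * (ENNReal.ofReal (g σ z) *
          ∫⁻ r in Ioi (0 : ℝ), V s z r) := by
        rw [lintegral_finsetSum]
        · simp only [lintegral_const_mul' _ _ ENNReal.ofReal_ne_top]
        · exact fun s _ ↦ (hgm.mul (hIm s)).const_mul _
    _ = ∫⁻ z, ENNReal.ofReal (g σ z) * ∫⁻ r in Ioi (0 : ℝ),
          ∑ s ∈ C, ENNReal.ofReal (1 / (C.card : ℝ)) * V s z r := by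
        refine lintegral_congr fun z ↦ ?_
        rw [lintegral_finsetSum, Finset.mul_sum]
        · simp only [lintegral_const_mul' _ _ ENNReal.ofReal_ne_top, mul_left_comm]
        · exact fun s _ ↦ Measurable.const_mul
            ((hVm s).comp (measurable_const.prodMk measurable_id)) _
    _ ≤ _ := by
        refine lintegral_mono fun z ↦ mul_le_mul_right (setLIntegral_mono' measurableSet_Ioi
          fun r (hr : 0 < r) ↦ ?_) _
        simp only [hV, mul_left_comm _ (ENNReal.ofReal (gs n σ r))]
        rw [← Finset.mul_sum]
        refine mul_le_mul_right ?_ _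
        simp only [← ENNReal.ofReal_mul hM0]
        rw [← ENNReal.ofReal_sum_of_nonneg fun s _ ↦
          mul_nonneg hM0 (le_min (condUnionBound_nonneg hn C s z hr) zero_le_one)]
        exact ENNReal.ofReal_le_ofReal (sum_min_condUnionBound_le ⟨_, (hD 0).1⟩ z r)

end TSB

theorem mainTheorem2 (n : ℕ) (hn : 3 ≤ n) (σ : ℝ) (hσ : 0 < σ)
    (C : Finset (EuclideanSpace ℝ (Fin n))) (hC : ∀ s ∈ C, s ≠ 0)
    (D : EuclideanSpace ℝ (Fin n) → EuclideanSpace ℝ (Fin n)) (hD : TSB.IsMLDecoder σ C D) :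
    TSB.errorProb σ C D ≤
      ∫ z : ℝ, min (∫ r in Set.Ioi (0 : ℝ), min (TSB.fs C z r) 1 * TSB.gs n σ r) 1 * TSB.g σ z := by
  -- the conditional bound given `z`; it is at most `1`, so that the outer minimum is superfluous
  set Φ : ℝ → ℝ≥0∞ := fun z ↦ ∫⁻ r in Ioi (0 : ℝ), ENNReal.ofReal (TSB.gs n σ r) *
    ENNReal.ofReal (min (TSB.fs C z r) 1) with hΦ
  have hfm := TSB.measurable_fs C
  have hgsm := TSB.measurable_gs n σ
  have hgm := TSB.measurable_g σ
  have hfs0 : ∀ z, ∀ r ∈ Ioi (0 : ℝ), 0 ≤ min (TSB.fs C z r) 1 := by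
    intro z r hr
    refine le_min ?_ zero_le_one
    rw [TSB.fs_eq_sum_condUnionBound]
    exact Finset.sum_nonneg fun s _ ↦
      mul_nonneg (by positivity) (TSB.condUnionBound_nonneg hn C s z hr)
  have hΦm : Measurable Φ := by
    have : Measurable fun q : ℝ × ℝ ↦ ENNReal.ofReal (TSB.gs n σ q.2) *
        ENNReal.ofReal (min (TSB.fs C q.1 q.2) 1) :=
      (hgsm.comp measurable_snd).ennreal_ofReal.mul (hfm.min measurable_const).ennreal_ofReal
    exact this.lintegral_prod_right'
  have hΦ1 : ∀ z, Φ z ≤ 1 := by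
    intro z
    rw [← TSB.lintegral_gs (n := n) (by lia) hσ]
    refine lintegral_mono fun r ↦ mul_le_of_le_one_right' ?_
    exact ENNReal.ofReal_le_one.2 (min_le_right _ _)
  have hinner : ∀ z, min (∫ r in Ioi (0 : ℝ), min (TSB.fs C z r) 1 * TSB.gs n σ r) 1 =
      (Φ z).toReal := by
    intro z
    have hfz := hfm.comp (measurable_prodMk_left (x := z))
    simp only [Function.comp_def] at hfz
    rw [integral_eq_lintegral_of_nonneg_ae]
    · have : ∫⁻ r in Ioi (0 : ℝ), ENNReal.ofReal (min (TSB.fs C z r) 1 * TSB.gs n σ r) = Φ z := by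
        refine setLIntegral_congr_fun measurableSet_Ioi fun r hr ↦ ?_
        rw [ENNReal.ofReal_mul (hfs0 z r hr), mul_comm]
      rw [this]
      exact min_eq_left (ENNReal.toReal_le_of_le_ofReal zero_le_one (by simpa using hΦ1 z))
    · filter_upwards [ae_restrict_mem measurableSet_Ioi] with r hr
      exact mul_nonneg (hfs0 z r hr) (TSB.gs_nonneg (by lia) hσ (le_of_lt hr))
    · exact ((hfz.min measurable_const).mul hgsm).aestronglyMeasurable
  simp only [hinner]
  rw [integral_eq_lintegral_of_nonneg_ae
    (.of_forall fun z ↦ mul_nonneg ENNReal.toReal_nonneg (TSB.g_nonneg hσ z))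
    (hΦm.ennreal_toReal.mul hgm).aestronglyMeasurable]
  have houter : ∫⁻ z, ENNReal.ofReal ((Φ z).toReal * TSB.g σ z) =
      ∫⁻ z, ENNReal.ofReal (TSB.g σ z) * Φ z := by
    refine lintegral_congr fun z ↦ ?_
    rw [ENNReal.ofReal_mul ENNReal.toReal_nonneg, mul_comm,
      ENNReal.ofReal_toReal (ne_top_of_le_ne_top ENNReal.one_ne_top (hΦ1 z))]
  rw [houter]
  refine (ENNReal.ofReal_le_iff_le_toReal ?_).1 (TSB.ofReal_errorProb_le hn hσ hC hD)
  refine ne_top_of_le_ne_top ENNReal.one_ne_top ?_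
  rw [← TSB.lintegral_g hσ]
  exact lintegral_mono fun z ↦ mul_le_of_le_one_right' (hΦ1 z)
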